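/- **Lemma 4.2.** Let $\beta>0$, $\theta_{\rm left}\in\mathbb R$ and let $n\ge 1$ be an integer. Consider $n$ walkers (size-one shocks) on $\mathbb Z+\tfrac12$, several of which may share a position; the state of the system is the multiset of their positions. To a configuration associate the parameter profile $$\theta_i=\theta_{\rm left}-\beta\cdot\#\{\text{walkers at positions}< i\},\qquad i\in\mathbb Z .$$ This is a decreasing profile, changing finitely many times in integer multiples of $\beta$, from $\theta_{\rm left}$ at $-\infty$ to $\theta_{\rm right}=\theta_{\rm left}-n\beta$ at $+\infty$. Let the walkers evolve as a continuous-time Markov jump process in which, for every occupied position $Q-\tfrac12$ ($Q\in\mathbb Z$), one of the walkers there jumps * to $Q+\tfrac12$ with rate $e^{\theta_{Q-1}}-e^{\theta_Q}$ (so that $\theta_Q$ increases by $\beta$), and * to $Q-\tfrac32$ with rate $e^{-\theta_Q}-e^{-\theta_{Q-1}}$ (so that $\theta_{Q-1}$ decreases by $\beta$). Precisely, the process has right-continuous step paths with left limits and solves the martingale problem for the corresponding generator and all bounded functions of the configuration. Let the process start from a fixed configuration, and let $W(t)$ be its width at time $t$, i.e. the position of the rightmost walker minus the position of the leftmost walker.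 Then all moments of the width are bounded uniformly in time: for every integer $p\ge 0$, the variable $W(t)^p$ is integrable for every $t\ge 0$, and $$\sup_{t\ge 0}\ \mathbf E\big[W(t)^p\big]<\infty .$$ -/

import Mathlib

open MeasureTheory ProbabilityTheory Filter Topology
open scoped NNReal

noncomputable section

namespace Shocks

/-- The parameter profile `(θ_i)` produced by a finite collection `s` of shocks of size one. An
integer `Q ∈ s` (counted with multiplicity) stands for a size-one shock, or walker, located at
`Q - 1/2`, that is, between the sites `Q - 1` and `Q`. Every shock lowers the parameter by `β`, and
the profile equals `θl` to the left of all shocks. -/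
def profile (θl β : ℝ) (s : Multiset ℤ) (i : ℤ) : ℝ :=
  θl - β * (s.countP (fun Q => Q ≤ i) : ℝ)

/-- One of the walkers at `Q` (if there is any) is moved to `Q'`; the other walkers stay. The state
space `Sym ℤ n` consists of the multisets of `n` positions. -/
def move {n : ℕ} (s : Sym ℤ n) (Q Q' : ℤ) : Sym ℤ n :=
  ⟨if Q ∈ s.1 then Q' ::ₘ s.1.erase Q else s.1, by
    split_ifs with h
    · rw [Multiset.card_cons, Multiset.card_erase_add_one h]; exact s.2
    · exact s.2⟩

/-- The rate `e^{θ_L} - e^{θ_R}` of a jump to the right from `Q - 1/2`, where `θ_L = θ_{Q-1}` and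
`θ_R = θ_Q` are the parameter values on the two sides of `Q - 1/2`. -/
def rightRate (θl β : ℝ) (s : Multiset ℤ) (Q : ℤ) : ℝ :=
  Real.exp (profile θl β s (Q - 1)) - Real.exp (profile θl β s Q)

/-- The rate `e^{-θ_R} - e^{-θ_L}` of a jump to the left from `Q - 1/2`. -/
def leftRate (θl β : ℝ) (s : Multiset ℤ) (Q : ℤ) : ℝ :=
  Real.exp (-profile θl β s Q) - Real.exp (-profile θl β s (Q - 1))

/-- The infinitesimal generator of the system of `n` walkers: from every occupied position `Q - 1/2`
one walker steps to `Q + 1/2` with rate `rightRate`, and one walker steps to `Q - 3/2` with rate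
`leftRate`. -/
def generator (θl β : ℝ) {n : ℕ} (f : Sym ℤ n → ℝ) (s : Sym ℤ n) : ℝ :=
  ∑ Q ∈ s.1.toFinset,
    (rightRate θl β s.1 Q * (f (move s Q (Q + 1)) - f s) +
      leftRate θl β s.1 Q * (f (move s Q (Q - 1)) - f s))

/-- `X` is a continuous-time Markov jump process of `n` walkers with the jump rates above, started
from the configuration `x₀`: it is adapted to the filtration `𝓕`, its paths are right-continuous
step functions with left limits (the state space is countable and discrete), and it solves the
martingale problem for the generator, for all bounded functions. -/
structure IsWalkerProcess (θl β : ℝ) {n : ℕ} {Ω : Type*} {mΩ : MeasurableSpace Ω}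
    (P : Measure Ω) (𝓕 : Filtration ℝ≥0 mΩ) (x₀ : Sym ℤ n) (X : ℝ≥0 → Ω → Sym ℤ n) : Prop where
  adapted : ∀ t x, MeasurableSet[𝓕 t] {ω | X t ω = x}
  right_continuous : ∀ ω t, ∀ᶠ s in 𝓝[>] t, X s ω = X t ω
  left_limits : ∀ ω t, ∃ x, ∀ᶠ s in 𝓝[<] t, X s ω = x
  initial : ∀ᵐ ω ∂P, X 0 ω = x₀
  martingale : ∀ f : Sym ℤ n → ℝ, (∃ K, ∀ x, |f x| ≤ K) →
    Martingale (fun (t : ℝ≥0) ω =>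
      f (X t ω) - ∫ u in (0 : ℝ)..(t : ℝ), generator θl β f (X u.toNNReal ω)) 𝓕 P

/-- The width of a configuration: the position of the rightmost walker minus the position of the
leftmost one. -/
def width {n : ℕ} (s : Sym ℤ n) : ℤ :=
  sSup {Q : ℤ | Q ∈ s.1} - sInf {Q : ℤ | Q ∈ s.1}

/-- A jump to the right from `Q - 1/2` raises `θ_Q` by `β` and changes nothing else. -/
theorem profile_move_right (θl β : ℝ) {n : ℕ} (s : Sym ℤ n) (Q : ℤ) (h : Q ∈ s.1) :
    profile θl β (move s Q (Q + 1)).1 =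
      Function.update (profile θl β s.1) Q (profile θl β s.1 Q + β) := by
  obtain ⟨t, ht⟩ := Multiset.exists_cons_of_mem h
  have hm : (move s Q (Q + 1)).1 = (Q + 1) ::ₘ t := by
    simp only [move]
    rw [if_pos h, ht, Multiset.erase_cons_head]
  rw [hm, ht]
  funext i
  rcases eq_or_ne i Q with rfl | hi
  · simp [profile, Multiset.countP_cons]
    ring
  · have h1 : (Q + 1 ≤ i) ↔ (Q ≤ i) := by omega
    simp only [Function.update_of_ne hi, profile, Multiset.countP_cons, h1]

/-- A jump to the left from `Q - 1/2` lowers `θ_{Q-1}` by `β` and changes nothing else. -/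
theorem profile_move_left (θl β : ℝ) {n : ℕ} (s : Sym ℤ n) (Q : ℤ) (h : Q ∈ s.1) :
    profile θl β (move s Q (Q - 1)).1 =
      Function.update (profile θl β s.1) (Q - 1) (profile θl β s.1 (Q - 1) - β) := by
  obtain ⟨t, ht⟩ := Multiset.exists_cons_of_mem h
  have hm : (move s Q (Q - 1)).1 = (Q - 1) ::ₘ t := by
    simp only [move]
    rw [if_pos h, ht, Multiset.erase_cons_head]
  rw [hm, ht]
  funext i
  rcases eq_or_ne i (Q - 1) with rfl | hi
  · simp [profile, Multiset.countP_cons]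
    ring
  · have h1 : (Q - 1 ≤ i) ↔ (Q ≤ i) := by omega
    simp only [Function.update_of_ne hi, profile, Multiset.countP_cons, h1]

end Shocks

end

namespace Shocks

/-! Number the walkers `x 0 ≤ x 1 ≤ ...` from the left. The rates at a site telescope, so walker `j`
effectively jumps right at rate `rightRank θl β j`, strictly decreasing in `j`, and left at rate
`leftRank θl β j`, strictly increasing in `j` (`generator_eq_sum_rank`). Hence any two walkers are
drawn together, whatever the configuration.

The Lyapunov function is `V = pairSum a`, the sum of `e^{a(x_j - x_i)}` over all ordered pairs. For
small `a > 0` the pairs with `i < j` have negative relative drift, and the other exponentials are at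
most `1`; so the generator satisfies `LV ≤ K - cV` (`exists_drift`). As `V` dominates `e^{a *
width}`, a uniform bound on `E V` bounds every moment.

The martingale problem covers only bounded functions, so the drift inequality is integrated for `min
V N` and then `N → ∞`: Fatou's lemma gives integrability, dominated convergence the integrated
inequality for `V`. A contraction over unit time steps gives the uniform bound
(`exists_integral_lyapunov_bound`). -/

/-! ### From occupied sites to ranked walkers. -/

theorem filter_range_eq_range_card (n : ℕ) (p : ℕ → Prop) [DecidablePred p]
    (hp : ∀ i j, i ≤ j → j < n → p j → p i) :
    (Finset.range n).filter p = Finset.range ((Finset.range n).filter p).card := by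
  induction n with
  | zero => simp
  | succ k ih =>
    have ih' := ih (fun i j hij hj => hp i j hij (by omega))
    by_cases hk : p k
    · have : (Finset.range (k + 1)).filter p = Finset.range (k + 1) := by
        apply Finset.filter_true_of_mem
        intro i hi
        rw [Finset.mem_range] at hi
        exact hp i k (by omega) (by omega) hk
      rw [this, Finset.card_range]
    · rw [Finset.range_add_one, Finset.filter_insert, if_neg hk]
      exact ih'

theorem countP_map_range (x : ℕ → ℤ) (n : ℕ) (Q : ℤ) :
    ((Multiset.range n).map x).countP (fun R => R ≤ Q) =
      ((Finset.range n).filter (fun j => x j ≤ Q)).card := by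
  rw [Multiset.countP_map]
  rfl

/-- Summing the increments of `φ ∘ (number of points ≤ ·)` over the occupied positions amounts to
summing the increments of `φ` over the points in increasing order. -/
theorem sum_increments_eq_sum_range (x : ℕ → ℤ) (n : ℕ)
    (hx : ∀ i j, i ≤ j → j < n → x i ≤ x j) (φ : ℕ → ℝ) (g : ℤ → ℝ) :
    ∑ Q ∈ ((Multiset.range n).map x).toFinset,
        (φ (((Multiset.range n).map x).countP (fun R => R ≤ Q)) -
          φ (((Multiset.range n).map x).countP (fun R => R ≤ Q - 1))) * g Q =
      ∑ j ∈ Finset.range n, (φ (j + 1) - φ j) * g (x j) := by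
  rw [← Finset.sum_fiberwise_of_maps_to (s := Finset.range n)
    (t := ((Multiset.range n).map x).toFinset) (g := x)]
  · refine Finset.sum_congr rfl fun Q _ => ?_
    have h0 : ∀ j ∈ (Finset.range n).filter (fun j => x j = Q),
        (φ (j + 1) - φ j) * g (x j) = (φ (j + 1) - φ j) * g Q := by
      intro j hj
      rw [(Finset.mem_filter.1 hj).2]
    rw [Finset.sum_congr rfl h0, ← Finset.sum_mul]
    congr 1
    have hsplit : (Finset.range n).filter (fun j => x j ≤ Q) =
        (Finset.range n).filter (fun j => x j ≤ Q - 1) ∪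
          (Finset.range n).filter (fun j => x j = Q) := by
      ext j
      simp only [Finset.mem_filter, Finset.mem_union, Finset.mem_range]
      omega
    have hdisj : Disjoint ((Finset.range n).filter (fun j => x j ≤ Q - 1))
        ((Finset.range n).filter (fun j => x j = Q)) := by
      rw [Finset.disjoint_left]
      intro j h1 h2
      simp only [Finset.mem_filter] at h1 h2
      omega
    -- By sortedness the indices with `x j ≤ R` form an initial segment, so the sum telescopes.
    have hlow : ∀ R : ℤ, ∑ j ∈ (Finset.range n).filter (fun j => x j ≤ R), (φ (j + 1) - φ j) =
        φ (((Multiset.range n).map x).countP (fun S => S ≤ R)) - φ 0 := by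
      intro R
      rw [countP_map_range, filter_range_eq_range_card n (fun j => x j ≤ R)
        (fun i j hij hj h => (hx i j hij hj).trans h), Finset.sum_range_sub, Finset.card_range]
    have h1 := hlow Q
    rw [hsplit, Finset.sum_union hdisj, hlow (Q - 1)] at h1
    linarith
  · intro j hj
    simp only [Multiset.mem_toFinset, Multiset.mem_map, Multiset.mem_range]
    exact ⟨j, Finset.mem_range.1 hj, rfl⟩

theorem exists_sorted_enumeration {n : ℕ} (s : Sym ℤ n) :
    ∃ x : ℕ → ℤ, (∀ i j, i ≤ j → j < n → x i ≤ x j) ∧ s.1 = (Multiset.range n).map x := by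
  have hlen : (s.1.sort (· ≤ ·)).length = n := by rw [Multiset.length_sort]; exact s.2
  -- The default `0` occurs only at indices `≥ n`, which are never consulted.
  refine ⟨fun j => (s.1.sort (· ≤ ·)).getD j 0, ?_, ?_⟩
  · intro i j hij hj
    have hs := Multiset.pairwise_sort s.1 (· ≤ ·)
    simp only [List.getD_eq_getElem _ _ (hlen.symm ▸ hj : j < (s.1.sort (· ≤ ·)).length),
      List.getD_eq_getElem _ _ (hlen.symm ▸ (lt_of_le_of_lt hij hj) :
        i < (s.1.sort (· ≤ ·)).length)]
    rcases hij.eq_or_lt with rfl | h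
    · exact le_rfl
    · exact List.pairwise_iff_getElem.1 hs _ _ _ _ h
  · conv_lhs => rw [← Multiset.sort_eq s.1 (· ≤ ·)]
    rw [← Multiset.coe_range, Multiset.map_coe, Multiset.coe_eq_coe]
    refine List.Perm.of_eq (List.ext_getElem (by simp) ?_)
    intro i h1 h2
    simp only [List.getElem_map, List.getElem_range, List.getD_eq_getElem _ _ h1]

/-! ### Bounds on rates; the generator on bounded and truncated functions. -/

theorem profile_le (θl β : ℝ) (hβ : 0 ≤ β) (s : Multiset ℤ) (i : ℤ) : profile θl β s i ≤ θl := by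
  unfold profile
  have : 0 ≤ β * (s.countP (fun Q => Q ≤ i) : ℝ) := by positivity
  linarith

theorem le_profile (θl β : ℝ) (hβ : 0 ≤ β) {n : ℕ} (s : Sym ℤ n) (i : ℤ) :
    θl - β * n ≤ profile θl β s.1 i := by
  unfold profile
  have h : s.1.countP (fun Q => Q ≤ i) ≤ n := (Multiset.countP_le_card _ _).trans_eq s.2
  have : β * (s.1.countP (fun Q => Q ≤ i) : ℝ) ≤ β * n := by gcongr
  linarith

theorem profile_antitone (θl β : ℝ) (hβ : 0 ≤ β) (s : Multiset ℤ) :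
    Antitone (profile θl β s) := by
  intro i j hij
  unfold profile
  have h : s.countP (fun Q => Q ≤ i) ≤ s.countP (fun Q => Q ≤ j) := by
    rw [Multiset.countP_eq_card_filter, Multiset.countP_eq_card_filter]
    exact Multiset.card_le_card (Multiset.monotone_filter_right s fun b hb => hb.trans hij)
  have : β * (s.countP (fun Q => Q ≤ i) : ℝ) ≤ β * (s.countP (fun Q => Q ≤ j) : ℝ) := by gcongr
  linarith

theorem rightRate_nonneg (θl β : ℝ) (hβ : 0 ≤ β) (s : Multiset ℤ) (Q : ℤ) :
    0 ≤ rightRate θl β s Q := by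
  unfold rightRate
  have := Real.exp_le_exp.2 (profile_antitone θl β hβ s (by omega : Q - 1 ≤ Q))
  linarith

theorem leftRate_nonneg (θl β : ℝ) (hβ : 0 ≤ β) (s : Multiset ℤ) (Q : ℤ) :
    0 ≤ leftRate θl β s Q := by
  unfold leftRate
  have := Real.exp_le_exp.2 (neg_le_neg (profile_antitone θl β hβ s (by omega : Q - 1 ≤ Q)))
  linarith

theorem rightRate_le (θl β : ℝ) (hβ : 0 ≤ β) (s : Multiset ℤ) (Q : ℤ) :
    rightRate θl β s Q ≤ Real.exp θl := by
  unfold rightRate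
  have := Real.exp_le_exp.2 (profile_le θl β hβ s (Q - 1))
  have := Real.exp_pos (profile θl β s Q)
  linarith

theorem leftRate_le (θl β : ℝ) (hβ : 0 ≤ β) {n : ℕ} (s : Sym ℤ n) (Q : ℤ) :
    leftRate θl β s.1 Q ≤ Real.exp (-(θl - β * n)) := by
  unfold leftRate
  have := Real.exp_le_exp.2 (neg_le_neg (le_profile θl β hβ s Q))
  have := Real.exp_pos (-profile θl β s.1 (Q - 1))
  linarith

/-- The profile stays in `[θl - β n, θl]`, so the rates are bounded uniformly over configurations.
This makes the time integral in the martingale integrable. -/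
theorem exists_generator_bound (θl β : ℝ) (hβ : 0 ≤ β) {n : ℕ} (f : Sym ℤ n → ℝ)
    (hf : ∃ K, ∀ x, |f x| ≤ K) : ∃ K, ∀ x, |generator θl β f x| ≤ K := by
  obtain ⟨K, hK⟩ := hf
  refine ⟨n * (Real.exp θl * (K + K) + Real.exp (-(θl - β * n)) * (K + K)), fun x => ?_⟩
  have hK0 : 0 ≤ K := (abs_nonneg _).trans (hK x)
  have hd : ∀ y, |f y - f x| ≤ K + K := fun y =>
    (abs_sub (f y) (f x)).trans (add_le_add (hK y) (hK x))
  unfold generator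
  refine (Finset.abs_sum_le_sum_abs _ _).trans ?_
  have hterm : ∀ Q ∈ x.1.toFinset,
      |rightRate θl β x.1 Q * (f (move x Q (Q + 1)) - f x) +
        leftRate θl β x.1 Q * (f (move x Q (Q - 1)) - f x)| ≤
      Real.exp θl * (K + K) + Real.exp (-(θl - β * n)) * (K + K) := by
    intro Q _
    refine (abs_add_le _ _).trans (add_le_add ?_ ?_)
    · rw [abs_mul, abs_of_nonneg (rightRate_nonneg θl β hβ x.1 Q)]
      exact mul_le_mul (rightRate_le θl β hβ x.1 Q) (hd _) (abs_nonneg _) (Real.exp_pos _).le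
    · rw [abs_mul, abs_of_nonneg (leftRate_nonneg θl β hβ x.1 Q)]
      exact mul_le_mul (leftRate_le θl β hβ x Q) (hd _) (abs_nonneg _) (Real.exp_pos _).le
  refine (Finset.sum_le_card_nsmul _ _ _ hterm).trans ?_
  rw [nsmul_eq_mul]
  have hc : x.1.toFinset.card ≤ n := (Multiset.toFinset_card_le _).trans_eq x.2
  gcongr

/-- The truncation of a function with negative drift has negative drift below the truncation
level. -/
theorem generator_min_le (θl β : ℝ) (hβ : 0 ≤ β) {n : ℕ} (V : Sym ℤ n → ℝ) (N : ℝ)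
    (x : Sym ℤ n) :
    generator θl β (fun y => min (V y) N) x ≤ if V x < N then generator θl β V x else 0 := by
  split_ifs with h
  · unfold generator
    refine Finset.sum_le_sum fun Q _ => ?_
    have h1 := rightRate_nonneg θl β hβ x.1 Q
    have h2 := leftRate_nonneg θl β hβ x.1 Q
    simp only [min_eq_left h.le]
    gcongr <;> exact min_le_left _ _
  · unfold generator
    refine Finset.sum_nonpos fun Q _ => ?_
    have h1 := rightRate_nonneg θl β hβ x.1 Q
    have h2 := leftRate_nonneg θl β hβ x.1 Q
    simp only [min_eq_right (not_lt.1 h)]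
    have h3 := min_le_right (V (move x Q (Q + 1))) N
    have h4 := min_le_right (V (move x Q (Q - 1))) N
    exact add_nonpos (mul_nonpos_of_nonneg_of_nonpos h1 (by linarith))
      (mul_nonpos_of_nonneg_of_nonpos h2 (by linarith))

/-! ### The Lyapunov function and its control of the width. -/

/-- The exponential sum `∑ e^{aQ}` over the positions `Q` of the walkers. -/
noncomputable def expSum (a : ℝ) (s : Multiset ℤ) : ℝ := (s.map fun Q : ℤ => Real.exp (a * Q)).sum

/-- The function `∑ e^{a(Q - Q')}`, the sum being over all pairs of walkers. -/
noncomputable def pairSum (a : ℝ) {n : ℕ} (s : Sym ℤ n) : ℝ := expSum a s.1 * expSum (-a) s.1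

theorem expSum_move (a : ℝ) {n : ℕ} (s : Sym ℤ n) (Q Q' : ℤ) (h : Q ∈ s.1) :
    expSum a (move s Q Q').1 = expSum a s.1 + (Real.exp (a * Q') - Real.exp (a * Q)) := by
  obtain ⟨t, ht⟩ := Multiset.exists_cons_of_mem h
  have hm : (move s Q Q').1 = Q' ::ₘ t := by
    simp only [move]
    rw [if_pos h, ht, Multiset.erase_cons_head]
  rw [hm, ht]
  simp only [expSum, Multiset.map_cons, Multiset.sum_cons]
  ring

theorem exp_le_expSum (a : ℝ) (s : Multiset ℤ) (Q : ℤ) (h : Q ∈ s) :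
    Real.exp (a * Q) ≤ expSum a s := by
  obtain ⟨t, rfl⟩ := Multiset.exists_cons_of_mem h
  have : 0 ≤ expSum a t := Multiset.sum_nonneg fun y hy => by
    obtain ⟨R, _, rfl⟩ := Multiset.mem_map.1 hy
    exact (Real.exp_pos _).le
  simp only [expSum, Multiset.map_cons, Multiset.sum_cons] at this ⊢
  linarith

theorem expSum_nonneg (a : ℝ) (s : Multiset ℤ) : 0 ≤ expSum a s :=
  Multiset.sum_nonneg fun y hy => by
    obtain ⟨R, _, rfl⟩ := Multiset.mem_map.1 hy
    exact (Real.exp_pos _).le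

theorem pairSum_nonneg (a : ℝ) {n : ℕ} (s : Sym ℤ n) : 0 ≤ pairSum a s :=
  mul_nonneg (expSum_nonneg _ _) (expSum_nonneg _ _)

theorem exists_width_eq {n : ℕ} (hn : 0 < n) (s : Sym ℤ n) :
    ∃ Q ∈ s.1, ∃ R ∈ s.1, width s = Q - R ∧ R ≤ Q := by
  have hne : {Q : ℤ | Q ∈ s.1}.Nonempty := by
    have : 0 < Multiset.card s.1 := by rw [s.2]; exact hn
    exact Multiset.card_pos_iff_exists_mem.1 this
  have hfin : {Q : ℤ | Q ∈ s.1}.Finite := by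
    convert s.1.toFinset.finite_toSet using 1
    ext; simp
  refine ⟨_, hne.csSup_mem hfin, _, hne.csInf_mem hfin, rfl, ?_⟩
  exact csInf_le_csSup hne hfin.bddBelow hfin.bddAbove

theorem width_nonneg {n : ℕ} (hn : 0 < n) (s : Sym ℤ n) : 0 ≤ width s := by
  obtain ⟨Q, _, R, _, h, hle⟩ := exists_width_eq hn s
  omega

/-- The rightmost and leftmost walkers form one of the pairs, and all terms are positive. -/
theorem exp_width_le_pairSum (a : ℝ) {n : ℕ} (hn : 0 < n) (s : Sym ℤ n) :
    Real.exp (a * width s) ≤ pairSum a s := by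
  obtain ⟨Q, hQ, R, hR, h, -⟩ := exists_width_eq hn s
  have : Real.exp (a * width s) = Real.exp (a * Q) * Real.exp (-a * R) := by
    rw [← Real.exp_add, h]
    push_cast
    ring_nf
  rw [this]
  exact mul_le_mul (exp_le_expSum a _ Q hQ) (exp_le_expSum (-a) _ R hR) (Real.exp_pos _).le
    (expSum_nonneg _ _)

theorem width_pow_le (a : ℝ) (ha : 0 < a) {n : ℕ} (hn : 0 < n) (s : Sym ℤ n) (p : ℕ) :
    (width s : ℝ) ^ p ≤ (p.factorial : ℝ) / a ^ p * pairSum a s := by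
  have hw : (0 : ℝ) ≤ width s := by exact_mod_cast width_nonneg hn s
  have h := (Real.pow_div_factorial_le_exp (a * width s) (by positivity) p).trans
    (exp_width_le_pairSum a hn s)
  rw [mul_pow, div_le_iff₀ (by positivity)] at h
  rw [div_mul_eq_mul_div, le_div_iff₀ (by positivity)]
  linarith

/-! ### Rates by rank and attraction between two walkers. -/

/-- The rate `e^{θ} - e^{θ - β}` to the right of the walker with `j` walkers before it. -/
noncomputable def rightRank (θl β : ℝ) (j : ℕ) : ℝ :=
  Real.exp (θl - β * j) - Real.exp (θl - β * (j + 1 : ℕ))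

/-- The rate to the left of the walker with `j` walkers before it. -/
noncomputable def leftRank (θl β : ℝ) (j : ℕ) : ℝ :=
  Real.exp (-(θl - β * (j + 1 : ℕ))) - Real.exp (-(θl - β * j))

theorem rightRank_pos (θl β : ℝ) (hβ : 0 < β) (j : ℕ) : 0 < rightRank θl β j := by
  unfold rightRank
  rw [sub_pos, Real.exp_lt_exp]
  push_cast
  linarith

theorem leftRank_pos (θl β : ℝ) (hβ : 0 < β) (j : ℕ) : 0 < leftRank θl β j := by
  unfold leftRank
  rw [sub_pos, Real.exp_lt_exp]
  push_cast
  linarith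

theorem rightRank_lt (θl β : ℝ) (hβ : 0 < β) {i j : ℕ} (hij : i < j) :
    rightRank θl β j < rightRank θl β i := by
  have h : ∀ k : ℕ, rightRank θl β k = Real.exp (θl - β * k) * (1 - Real.exp (-β)) := by
    intro k
    unfold rightRank
    rw [mul_sub, mul_one, ← Real.exp_add]
    push_cast
    ring_nf
  have h1 : 0 < 1 - Real.exp (-β) := by
    rw [sub_pos, Real.exp_lt_one_iff]
    linarith
  have h2 : (i : ℝ) < j := by exact_mod_cast hij
  rw [h, h]
  gcongr

theorem leftRank_lt (θl β : ℝ) (hβ : 0 < β) {i j : ℕ} (hij : i < j) :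
    leftRank θl β i < leftRank θl β j := by
  have h : ∀ k : ℕ, leftRank θl β k = Real.exp (-(θl - β * k)) * (Real.exp β - 1) := by
    intro k
    unfold leftRank
    rw [mul_sub, mul_one, ← Real.exp_add]
    push_cast
    ring_nf
  have h1 : 0 < Real.exp β - 1 := by
    rw [sub_pos, Real.one_lt_exp_iff]
    exact hβ
  have h2 : (i : ℝ) < j := by exact_mod_cast hij
  rw [h, h]
  gcongr

/-- The relative drift coefficient of `e^{a(x_j - x_i)}`. -/
noncomputable def pairDrift (θl β a : ℝ) (i j : ℕ) : ℝ :=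
  (rightRank θl β j * (Real.exp a - 1) + leftRank θl β j * (Real.exp (-a) - 1)) +
    (rightRank θl β i * (Real.exp (-a) - 1) + leftRank θl β i * (Real.exp a - 1))

/-- Since `e^{-a} - 1 = -e^{-a}(e^a - 1)`, a positive factor `e^a - 1` splits off. As `a → 0` the
other factor tends to the relative velocity of walkers `j` and `i`, which is negative by
monotonicity of the rates. -/
theorem eventually_pairDrift_neg (θl β : ℝ) (hβ : 0 < β) {i j : ℕ} (hij : i < j) :
    ∀ᶠ a in 𝓝[>] (0 : ℝ), pairDrift θl β a i j < 0 := by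
  have hc : Tendsto (fun a : ℝ => (rightRank θl β j + leftRank θl β i) -
      Real.exp (-a) * (leftRank θl β j + rightRank θl β i)) (𝓝[>] 0)
      (𝓝 ((rightRank θl β j + leftRank θl β i) -
        Real.exp (-0) * (leftRank θl β j + rightRank θl β i))) :=
    (Continuous.tendsto (by fun_prop) 0).mono_left nhdsWithin_le_nhds
  have hneg : (rightRank θl β j + leftRank θl β i) -
        Real.exp (-0) * (leftRank θl β j + rightRank θl β i) < 0 := by
    have h1 := rightRank_lt θl β hβ hij
    have h2 := leftRank_lt θl β hβ hij
    rw [neg_zero, Real.exp_zero]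
    linarith
  filter_upwards [hc.eventually_lt_const hneg, self_mem_nhdsWithin] with a ha ha0
  have hpos : 0 < Real.exp a - 1 := by
    rw [sub_pos, Real.one_lt_exp_iff]
    exact ha0
  have he : Real.exp a * Real.exp (-a) = 1 := by rw [← Real.exp_add]; simp
  have : pairDrift θl β a i j = (Real.exp a - 1) * ((rightRank θl β j + leftRank θl β i) -
      Real.exp (-a) * (leftRank θl β j + rightRank θl β i)) := by
    unfold pairDrift
    linear_combination (-(leftRank θl β j + rightRank θl β i)) * (-he)
  rw [this]
  exact mul_neg_of_pos_of_neg hpos ha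

theorem exists_pairDrift_le (θl β : ℝ) (hβ : 0 < β) (n : ℕ) :
    ∃ a > 0, ∃ c > 0, ∀ j ∈ Finset.range n, ∀ i ∈ Finset.range j, pairDrift θl β a i j ≤ -c := by
  have h : ∀ᶠ a in 𝓝[>] (0 : ℝ), ∀ j ∈ Finset.range n, ∀ i ∈ Finset.range j,
      pairDrift θl β a i j < 0 := by
    simp only [Filter.eventually_all_finset]
    intro j _ i hi
    exact eventually_pairDrift_neg θl β hβ (Finset.mem_range.1 hi)
  obtain ⟨a, ha, ha0⟩ := (h.and self_mem_nhdsWithin).exists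
  have h' : ∀ᶠ c in 𝓝[>] (0 : ℝ), ∀ j ∈ Finset.range n, ∀ i ∈ Finset.range j,
      pairDrift θl β a i j < -c := by
    simp only [Filter.eventually_all_finset]
    intro j hj i hi
    have hc : Tendsto (fun c : ℝ => -c) (𝓝[>] 0) (𝓝 (-0)) :=
      (Continuous.tendsto (by fun_prop) 0).mono_left nhdsWithin_le_nhds
    exact hc.eventually_const_lt (by simpa using ha j hj i hi)
  obtain ⟨c, hc, hc0⟩ := (h'.and self_mem_nhdsWithin).exists
  exact ⟨a, ha0, c, hc0, fun j hj i hi => (hc j hj i hi).le⟩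

/-! ### The drift inequality for the Lyapunov function. -/

/-- Walkers sharing a site yield the same configuration when one of them jumps, so only their total
rate matters, and the rank rates at a site add up to it. -/
theorem generator_eq_sum_rank (θl β : ℝ) {n : ℕ} (s : Sym ℤ n) (x : ℕ → ℤ)
    (hx : ∀ i j, i ≤ j → j < n → x i ≤ x j) (hs : s.1 = (Multiset.range n).map x)
    (f : Sym ℤ n → ℝ) :
    generator θl β f s = ∑ j ∈ Finset.range n,
      (rightRank θl β j * (f (move s (x j) (x j + 1)) - f s) +
        leftRank θl β j * (f (move s (x j) (x j - 1)) - f s)) := by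
  have hR := sum_increments_eq_sum_range x n hx (fun k => -Real.exp (θl - β * k))
    (fun Q => f (move s Q (Q + 1)) - f s)
  have hL := sum_increments_eq_sum_range x n hx (fun k => Real.exp (-(θl - β * k)))
    (fun Q => f (move s Q (Q - 1)) - f s)
  rw [← hs] at hR hL
  unfold generator
  rw [Finset.sum_add_distrib, Finset.sum_add_distrib]
  refine congrArg₂ (· + ·) ?_ hL
  convert hR using 2 with Q _ j _
  · unfold rightRate profile
    ring
  · unfold rightRank
    ring

theorem expSum_map_range (a : ℝ) (x : ℕ → ℤ) (n : ℕ) :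
    expSum a ((Multiset.range n).map x) = ∑ j ∈ Finset.range n, Real.exp (a * x j) := by
  unfold expSum
  rw [Multiset.map_map]
  rfl

theorem pairSum_eq_sum (a : ℝ) {n : ℕ} (s : Sym ℤ n) (x : ℕ → ℤ)
    (hs : s.1 = (Multiset.range n).map x) :
    pairSum a s = ∑ j ∈ Finset.range n, ∑ i ∈ Finset.range n, Real.exp (a * (x j - x i)) := by
  unfold pairSum
  rw [hs, expSum_map_range, expSum_map_range, Finset.sum_mul_sum]
  refine Finset.sum_congr rfl fun j _ => Finset.sum_congr rfl fun i _ => ?_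
  rw [← Real.exp_add]
  ring_nf

/-- A jump changes both factors of `pairSum`. The first-order changes give the right-hand side; the
product of the two changes is nonpositive by `hprod` and is dropped. It only concerns the diagonal
`i = j`, where the true drift is zero. -/
theorem generator_pairSum_le_sum (θl β : ℝ) (hβ : 0 < β) (a : ℝ) {n : ℕ} (s : Sym ℤ n)
    (x : ℕ → ℤ) (hx : ∀ i j, i ≤ j → j < n → x i ≤ x j)
    (hs : s.1 = (Multiset.range n).map x) :
    generator θl β (pairSum a) s ≤ ∑ j ∈ Finset.range n, ∑ i ∈ Finset.range n,
      pairDrift θl β a i j * Real.exp (a * (x j - x i)) := by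
  have hsum : ∀ b, expSum b s.1 = ∑ j ∈ Finset.range n, Real.exp (b * x j) := fun b => by
    rw [hs, expSum_map_range]
  have hexp : Real.exp a * Real.exp (-a) = 1 := by rw [← Real.exp_add]; simp
  have hprod : (Real.exp a - 1) * (Real.exp (-a) - 1) ≤ 0 := by
    nlinarith [Real.add_one_le_exp a, Real.add_one_le_exp (-a)]
  have hstep : ∀ j ∈ Finset.range n,
      rightRank θl β j * (pairSum a (move s (x j) (x j + 1)) - pairSum a s) +
        leftRank θl β j * (pairSum a (move s (x j) (x j - 1)) - pairSum a s) ≤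
      (rightRank θl β j * (Real.exp a - 1) + leftRank θl β j * (Real.exp (-a) - 1)) *
          (Real.exp (a * x j) * expSum (-a) s.1) +
        (rightRank θl β j * (Real.exp (-a) - 1) + leftRank θl β j * (Real.exp a - 1)) *
          (Real.exp (-a * x j) * expSum a s.1) := by
    intro j hj
    have hmem : x j ∈ s.1 := by
      rw [hs, Multiset.mem_map]
      exact ⟨j, Multiset.mem_range.2 (Finset.mem_range.1 hj), rfl⟩
    have hr := rightRank_pos θl β hβ j
    have hl := leftRank_pos θl β hβ j
    have e1 : Real.exp (a * (x j + 1 : ℤ)) = Real.exp (a * x j) * Real.exp a := by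
      rw [← Real.exp_add]; push_cast; ring_nf
    have e2 : Real.exp (-a * (x j + 1 : ℤ)) = Real.exp (-a * x j) * Real.exp (-a) := by
      rw [← Real.exp_add]; push_cast; ring_nf
    have e3 : Real.exp (a * (x j - 1 : ℤ)) = Real.exp (a * x j) * Real.exp (-a) := by
      rw [← Real.exp_add]; push_cast; ring_nf
    have e4 : Real.exp (-a * (x j - 1 : ℤ)) = Real.exp (-a * x j) * Real.exp a := by
      rw [← Real.exp_add]; push_cast; ring_nf
    have e5 : Real.exp (a * x j) * Real.exp (-a * x j) = 1 := by
      rw [← Real.exp_add]; simp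
    unfold pairSum
    rw [expSum_move _ _ _ _ hmem, expSum_move _ _ _ _ hmem, expSum_move _ _ _ _ hmem,
      expSum_move _ _ _ _ hmem, e1, e2, e3, e4]
    have hneg : (rightRank θl β j + leftRank θl β j) *
        ((Real.exp a - 1) * (Real.exp (-a) - 1)) ≤ 0 :=
      mul_nonpos_of_nonneg_of_nonpos (by linarith) hprod
    rw [← sub_nonneg]
    refine (neg_nonneg.2 hneg).trans_eq ?_
    linear_combination ((rightRank θl β j + leftRank θl β j) *
        ((Real.exp a - 1) * (Real.exp (-a) - 1))) * e5
  rw [generator_eq_sum_rank θl β s x hx hs]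
  refine (Finset.sum_le_sum hstep).trans_eq ?_
  rw [Finset.sum_add_distrib]
  have h2 : ∑ j ∈ Finset.range n,
        (rightRank θl β j * (Real.exp (-a) - 1) + leftRank θl β j * (Real.exp a - 1)) *
          (Real.exp (-a * x j) * expSum a s.1) =
      ∑ j ∈ Finset.range n, ∑ i ∈ Finset.range n,
        (rightRank θl β i * (Real.exp (-a) - 1) + leftRank θl β i * (Real.exp a - 1)) *
          Real.exp (a * (x j - x i)) := by
    rw [Finset.sum_comm]
    refine Finset.sum_congr rfl fun i _ => ?_
    rw [hsum, Finset.mul_sum, Finset.mul_sum]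
    refine Finset.sum_congr rfl fun j _ => ?_
    rw [← Real.exp_add]
    ring_nf
  rw [h2, ← Finset.sum_add_distrib]
  refine Finset.sum_congr rfl fun j _ => ?_
  rw [hsum, Finset.mul_sum, Finset.mul_sum, ← Finset.sum_add_distrib]
  refine Finset.sum_congr rfl fun i _ => ?_
  unfold pairDrift
  rw [← Real.exp_add, add_mul]
  ring_nf

/-- For small `a` the function `pairSum a` has a negative drift. -/
theorem exists_drift (θl β : ℝ) (hβ : 0 < β) (n : ℕ) :
    ∃ a > 0, ∃ c > 0, ∃ K ≥ 0, ∀ s : Sym ℤ n,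
      generator θl β (pairSum a) s ≤ K - c * pairSum a s := by
  obtain ⟨a, ha, c, hc, hdrift⟩ := exists_pairDrift_le θl β hβ n
  refine ⟨a, ha, c, hc,
    -- Each pair with `j ≤ i` has exponential at most `1` and costs at most its summand; for `i < j`
    -- the summand is mere slack.
    ∑ j ∈ Finset.range n, ∑ i ∈ Finset.range n, (|pairDrift θl β a i j| + c), by positivity,
    fun s => ?_⟩
  obtain ⟨x, hx, hs⟩ := exists_sorted_enumeration s
  refine (generator_pairSum_le_sum θl β hβ a s x hx hs).trans ?_
  rw [pairSum_eq_sum a s x hs, Finset.mul_sum, ← Finset.sum_sub_distrib]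
  refine Finset.sum_le_sum fun j hj => ?_
  rw [Finset.mul_sum, ← Finset.sum_sub_distrib]
  refine Finset.sum_le_sum fun i hi => ?_
  have hE := Real.exp_pos (a * (x j - x i))
  have habs := abs_nonneg (pairDrift θl β a i j)
  have hle := le_abs_self (pairDrift θl β a i j)
  rcases lt_or_ge i j with hij | hij
  · have h1 := hdrift j hj i (Finset.mem_range.2 hij)
    have := mul_le_mul_of_nonneg_right h1 hE.le
    linarith
  · have hxx : (x j : ℝ) ≤ x i := by exact_mod_cast hx j i hij (Finset.mem_range.1 hi)
    have hE1 : Real.exp (a * (x j - x i)) ≤ 1 := by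
      rw [Real.exp_le_one_iff]
      exact mul_nonpos_of_nonneg_of_nonpos ha.le (by linarith)
    have h1 := mul_le_mul_of_nonneg_right hle hE.le
    have h2 := mul_le_mul_of_nonneg_left hE1 (add_nonneg habs hc.le)
    linarith

/-! ### Removing a truncation level under the integral. -/

section Truncation

variable {Ω : Type*} {mΩ : MeasurableSpace Ω} {P : Measure Ω}

theorem tendsto_integral_min {Y : Ω → ℝ} (hY : Integrable Y P) (hY0 : ∀ ω, 0 ≤ Y ω) :
    Tendsto (fun N : ℕ => ∫ ω, min (Y ω) N ∂P) atTop (𝓝 (∫ ω, Y ω ∂P)) := by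
  refine tendsto_integral_of_dominated_convergence Y
    (fun N => (hY.1.aemeasurable.min aemeasurable_const).aestronglyMeasurable) hY ?_ ?_
  · refine fun N => ae_of_all _ fun ω => ?_
    rw [Real.norm_of_nonneg (le_min (hY0 ω) N.cast_nonneg)]
    exact min_le_left _ _
  · refine ae_of_all _ fun ω => tendsto_const_nhds.congr' ?_
    filter_upwards [eventually_ge_atTop ⌈Y ω⌉₊] with N hN
    rw [min_eq_left (Nat.ceil_le.1 hN)]

theorem tendsto_integral_ite_lt {Y : Ω → ℝ} (hYm : Measurable Y) (hY : Integrable Y P)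
    (hY0 : ∀ ω, 0 ≤ Y ω) :
    Tendsto (fun N : ℕ => ∫ ω, (if Y ω < N then Y ω else 0) ∂P) atTop (𝓝 (∫ ω, Y ω ∂P)) := by
  refine tendsto_integral_of_dominated_convergence Y (fun N => ?_) hY ?_ ?_
  · exact (Measurable.ite (measurableSet_lt hYm measurable_const) hYm
      measurable_const).aestronglyMeasurable
  · refine fun N => ae_of_all _ fun ω => ?_
    split_ifs
    · rw [Real.norm_of_nonneg (hY0 ω)]
    · simpa using hY0 ω
  · refine ae_of_all _ fun ω => tendsto_const_nhds.congr' ?_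
    filter_upwards [eventually_gt_atTop ⌈Y ω⌉₊] with N hN
    rw [if_pos (Nat.lt_of_ceil_lt hN)]

/-- Fatou's lemma along the truncations. -/
theorem integrable_of_integral_min_le [IsFiniteMeasure P] {Y : Ω → ℝ} (hYm : Measurable Y) (hY0 : ∀ ω, 0 ≤ Y ω)
    (B : ℝ) (hB : ∀ N : ℕ, ∫ ω, min (Y ω) N ∂P ≤ B) : Integrable Y P := by
  refine ⟨hYm.aestronglyMeasurable, lt_of_le_of_lt (b := ENNReal.ofReal B) ?_
    ENNReal.ofReal_lt_top⟩
  have hlim : ∀ ω, Tendsto (fun N : ℕ => ENNReal.ofReal (min (Y ω) N)) atTop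
      (𝓝 (ENNReal.ofReal (Y ω))) := fun ω => by
    refine tendsto_const_nhds.congr' ?_
    filter_upwards [eventually_ge_atTop ⌈Y ω⌉₊] with N hN
    rw [min_eq_left (Nat.ceil_le.1 hN)]
  have hmeas : ∀ N : ℕ, Measurable fun ω => min (Y ω) N := fun N => hYm.min measurable_const
  calc ∫⁻ ω, ‖Y ω‖ₑ ∂P = ∫⁻ ω, liminf (fun N : ℕ => ENNReal.ofReal (min (Y ω) N)) atTop ∂P := by
        refine lintegral_congr fun ω => ?_
        rw [(hlim ω).liminf_eq, Real.enorm_eq_ofReal (hY0 ω)]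
    _ ≤ liminf (fun N : ℕ => ∫⁻ ω, ENNReal.ofReal (min (Y ω) N) ∂P) atTop :=
        lintegral_liminf_le fun N => (hmeas N).ennreal_ofReal
    _ ≤ ENNReal.ofReal B := by
        refine liminf_le_of_frequently_le' (Frequently.of_forall fun N => ?_)
        rw [← ofReal_integral_eq_lintegral_ofReal]
        · exact ENNReal.ofReal_le_ofReal (hB N)
        · refine Integrable.of_bound (hmeas N).aestronglyMeasurable N (ae_of_all _ fun ω => ?_)
          rw [Real.norm_of_nonneg (le_min (hY0 ω) N.cast_nonneg)]
          exact min_le_right _ _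
        · exact ae_of_all _ fun ω => le_min (hY0 ω) N.cast_nonneg

end Truncation

/-! ### Joint measurability and Dynkin's formula. -/

theorem measurable_comp_prod_nat {α Ω : Type*} [MeasurableSpace α] [MeasurableSpace Ω]
    {Y : ℕ → Ω → ℝ} {m : α → ℕ} (hY : ∀ k, Measurable (Y k)) (hm : Measurable m) :
    Measurable fun q : α × Ω => Y (m q.1) q.2 := by
  have h1 : Measurable fun q : ℕ × Ω => Y q.1 q.2 := measurable_from_prod_countable_right hY
  exact h1.comp ((hm.comp measurable_fst).prodMk measurable_snd)

namespace IsWalkerProcess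

variable {θl β : ℝ} {n : ℕ} {Ω : Type*} {mΩ : MeasurableSpace Ω} {P : Measure Ω}
  {𝓕 : Filtration ℝ≥0 mΩ} {x₀ : Sym ℤ n} {X : ℝ≥0 → Ω → Sym ℤ n}

theorem measurable_comp (hX : IsWalkerProcess θl β P 𝓕 x₀ X) (h : Sym ℤ n → ℝ) (t : ℝ≥0) :
    Measurable fun ω => h (X t ω) := by
  intro s _
  have : Countable (Sym ℤ n) := Subtype.countable
  have hset : (fun ω => h (X t ω)) ⁻¹' s = ⋃ x ∈ h ⁻¹' s, {ω | X t ω = x} := by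
    ext ω
    simp
  rw [hset]
  exact MeasurableSet.biUnion (Set.to_countable _) fun x _ => 𝓕.le t _ (hX.adapted t x)

/-- Right-continuity makes the process jointly measurable. -/
theorem measurable_uncurry (hX : IsWalkerProcess θl β P 𝓕 x₀ X) (h : Sym ℤ n → ℝ) :
    Measurable fun q : ℝ × Ω => h (X q.1.toNNReal q.2) := by
  -- The first multiple of `1/(k+1)` strictly after `u`: right-continuity is stated on the punctured
  -- neighbourhood `𝓝[>] u`.
  let T : ℕ → ℝ≥0 → ℝ≥0 := fun k u => (⌊u * (k + 1)⌋₊ + 1) / (k + 1)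
  have hmeas : ∀ k, Measurable fun q : ℝ × Ω => h (X (T k q.1.toNNReal) q.2) := by
    intro k
    refine measurable_comp_prod_nat (Y := fun (m : ℕ) ω => h (X ((m + 1) / (k + 1)) ω))
      (m := fun u : ℝ => ⌊u.toNNReal * (k + 1)⌋₊) (fun m => hX.measurable_comp h _) ?_
    exact Nat.measurable_floor.comp (measurable_real_toNNReal.mul_const _)
  have hT : ∀ u, Tendsto (fun k => T k u) atTop (𝓝[>] u) := by
    intro u
    have hlt : ∀ k, u < T k u := fun k => by
      have hk : (0 : ℝ≥0) < k + 1 := by positivity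
      rw [lt_div_iff₀ hk]
      exact Nat.lt_floor_add_one _
    have hle : ∀ k, T k u ≤ u + 1 / (k + 1) := fun k => by
      have hk : (0 : ℝ≥0) < k + 1 := by positivity
      rw [div_le_iff₀ hk, add_mul, div_mul_cancel₀ _ hk.ne']
      gcongr
      exact Nat.floor_le zero_le
    have hlim : Tendsto (fun k : ℕ => u + 1 / ((k : ℝ≥0) + 1)) atTop (𝓝 u) := by
      simpa using tendsto_const_nhds.add (tendsto_one_div_add_atTop_nhds_zero_nat (𝕜 := ℝ≥0))
    exact tendsto_nhdsWithin_iff.2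
      ⟨tendsto_of_tendsto_of_tendsto_of_le_of_le tendsto_const_nhds hlim (fun k => (hlt k).le) hle,
        Eventually.of_forall hlt⟩
  refine measurable_of_tendsto_metrizable hmeas (tendsto_pi_nhds.2 fun q => ?_)
  refine tendsto_const_nhds.congr' ?_
  filter_upwards [(hT q.1.toNNReal).eventually (hX.right_continuous q.2 q.1.toNNReal)] with k hk
  rw [hk]

theorem integral_ite_nonneg {V : Sym ℤ n → ℝ} (hV : ∀ x, 0 ≤ V x) (N : ℕ) (u : ℝ≥0) :
    0 ≤ ∫ ω, (if V (X u ω) < N then V (X u ω) else 0) ∂P :=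
  integral_nonneg fun ω => by
    dsimp only
    split_ifs
    · exact hV _
    · exact le_rfl

variable [IsProbabilityMeasure P]

theorem integrable_comp (hX : IsWalkerProcess θl β P 𝓕 x₀ X) {h : Sym ℤ n → ℝ}
    (hh : ∃ K, ∀ x, |h x| ≤ K) (t : ℝ≥0) : Integrable (fun ω => h (X t ω)) P := by
  obtain ⟨K, hK⟩ := hh
  exact Integrable.of_bound (hX.measurable_comp h t).aestronglyMeasurable K
    (ae_of_all _ fun ω => hK _)

theorem integrable_uncurry (hX : IsWalkerProcess θl β P 𝓕 x₀ X) {h : Sym ℤ n → ℝ}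
    (hh : ∃ K, ∀ x, |h x| ≤ K) (s t : ℝ) :
    Integrable (fun q : ℝ × Ω => h (X q.1.toNNReal q.2))
      ((volume.restrict (Set.uIoc s t)).prod P) := by
  obtain ⟨K, hK⟩ := hh
  have : IsFiniteMeasure (volume.restrict (Set.uIoc s t)) := by
    unfold Set.uIoc
    infer_instance
  exact Integrable.of_bound (hX.measurable_uncurry h).aestronglyMeasurable K
    (ae_of_all _ fun q => hK _)

theorem measurable_integral (hX : IsWalkerProcess θl β P 𝓕 x₀ X) (h : Sym ℤ n → ℝ) :
    StronglyMeasurable fun u : ℝ => ∫ ω, h (X u.toNNReal ω) ∂P :=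
  (hX.measurable_uncurry h).stronglyMeasurable.integral_prod_right

theorem intervalIntegrable_integral (hX : IsWalkerProcess θl β P 𝓕 x₀ X) {h : Sym ℤ n → ℝ}
    (hh : ∃ K, ∀ x, |h x| ≤ K) (s t : ℝ) :
    IntervalIntegrable (fun u : ℝ => ∫ ω, h (X u.toNNReal ω) ∂P) volume s t := by
  rw [intervalIntegrable_iff]
  exact (hX.integrable_uncurry hh s t).integral_prod_left

/-- Dynkin's formula for bounded functions. -/
theorem integral_sub_integral (hX : IsWalkerProcess θl β P 𝓕 x₀ X) (hβ : 0 ≤ β)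
    {f : Sym ℤ n → ℝ} (hf : ∃ K, ∀ x, |f x| ≤ K) {s t : ℝ≥0} (hst : s ≤ t) :
    ∫ ω, f (X t ω) ∂P - ∫ ω, f (X s ω) ∂P =
      ∫ u in (s : ℝ)..t, ∫ ω, generator θl β f (X u.toNNReal ω) ∂P := by
  have hg := exists_generator_bound θl β hβ f hf
  have hfub : ∀ r : ℝ≥0, ∫ ω, (∫ u in (0 : ℝ)..r, generator θl β f (X u.toNNReal ω)) ∂P =
      ∫ u in (0 : ℝ)..r, ∫ ω, generator θl β f (X u.toNNReal ω) ∂P := fun r =>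
    (intervalIntegral_integral_swap (hX.integrable_uncurry hg 0 r)).symm
  have hint : ∀ r : ℝ≥0,
      Integrable (fun ω => ∫ u in (0 : ℝ)..r, generator θl β f (X u.toNNReal ω)) P := fun r => by
    simp only [intervalIntegral.intervalIntegral_eq_integral_uIoc]
    exact (hX.integrable_uncurry hg 0 r).integral_prod_right.smul (_ : ℝ)
  have hm := (hX.martingale f hf).setIntegral_eq hst MeasurableSet.univ
  simp only [Measure.restrict_univ] at hm
  rw [integral_sub (hX.integrable_comp hf s) (hint s),
    integral_sub (hX.integrable_comp hf t) (hint t), hfub, hfub] at hm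
  rw [← intervalIntegral.integral_add_adjacent_intervals
    (hX.intervalIntegrable_integral hg 0 s) (hX.intervalIntegrable_integral hg s t)] at hm
  linarith

/-! ### From the drift inequality to a bound uniform in time. -/

section Drift

variable {V : Sym ℤ n → ℝ} {c K : ℝ}

theorem exists_min_bound (hV : ∀ x, 0 ≤ V x) (N : ℕ) : ∃ B : ℝ, ∀ x, |min (V x) N| ≤ B :=
  ⟨N, fun x => by
    rw [abs_of_nonneg (le_min (hV x) N.cast_nonneg)]
    exact min_le_right _ _⟩

theorem exists_ite_bound (hV : ∀ x, 0 ≤ V x) (N : ℕ) :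
    ∃ B : ℝ, ∀ x, |if V x < N then V x else 0| ≤ B :=
  ⟨N, fun x => by
    split_ifs with h
    · rw [abs_of_nonneg (hV x)]
      exact h.le
    · simp⟩

theorem integral_min_add_le (hX : IsWalkerProcess θl β P 𝓕 x₀ X) (hβ : 0 ≤ β)
    (hV : ∀ x, 0 ≤ V x) (hK : 0 ≤ K)
    (hdrift : ∀ x, generator θl β V x ≤ K - c * V x) (N : ℕ) {s t : ℝ≥0} (hst : s ≤ t) :
    ∫ ω, min (V (X t ω)) N ∂P +
        c * ∫ u in (s : ℝ)..t, ∫ ω, (if V (X u.toNNReal ω) < N then V (X u.toNNReal ω) else 0) ∂P ≤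
      ∫ ω, min (V (X s ω)) N ∂P + K * (t - s) := by
  have hfb := exists_min_bound hV N
  have hAb := exists_ite_bound hV N
  have hgb := exists_generator_bound θl β hβ _ hfb
  have hst' : (s : ℝ) ≤ t := by exact_mod_cast hst
  have hdyn := hX.integral_sub_integral hβ hfb hst
  have hpt : ∀ x, generator θl β (fun y => min (V y) N) x ≤
      K - c * (if V x < N then V x else 0) := fun x => by
    refine (generator_min_le θl β hβ V N x).trans ?_
    split_ifs
    · exact hdrift x
    -- Above level `N` the truncated function has nonpositive drift, and `0 ≤ K`.
    · simpa using hK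
  have hAi := hX.intervalIntegrable_integral hAb s t
  have hle : ∫ u in (s : ℝ)..t, ∫ ω, generator θl β (fun y => min (V y) N) (X u.toNNReal ω) ∂P ≤
      ∫ u in (s : ℝ)..t, (K - c * ∫ ω,
        (if V (X u.toNNReal ω) < N then V (X u.toNNReal ω) else 0) ∂P) := by
    refine intervalIntegral.integral_mono_on hst' (hX.intervalIntegrable_integral hgb s t)
      (intervalIntegrable_const.sub (hAi.const_mul c)) fun u _ => ?_
    have hi := hX.integrable_comp hAb u.toNNReal
    calc _ ≤ ∫ ω, (K - c * (if V (X u.toNNReal ω) < N then V (X u.toNNReal ω) else 0)) ∂P :=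
          integral_mono (hX.integrable_comp hgb _) ((integrable_const K).sub (hi.const_mul c))
            fun ω => hpt _
      _ = _ := by
          rw [integral_sub (integrable_const K) (hi.const_mul c), integral_const_mul]
          simp
  rw [intervalIntegral.integral_sub intervalIntegrable_const (hAi.const_mul c),
    intervalIntegral.integral_const, intervalIntegral.integral_const_mul, smul_eq_mul] at hle
  linarith

/-- Crude in time but uniform in `N`, as Fatou's lemma requires. -/
theorem integral_min_le (hX : IsWalkerProcess θl β P 𝓕 x₀ X) (hβ : 0 ≤ β)
    (hV : ∀ x, 0 ≤ V x) (hc : 0 ≤ c) (hK : 0 ≤ K)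
    (hdrift : ∀ x, generator θl β V x ≤ K - c * V x) (N : ℕ) (t : ℝ≥0) :
    ∫ ω, min (V (X t ω)) N ∂P ≤ V x₀ + K * t := by
  have h := hX.integral_min_add_le hβ hV hK hdrift N (zero_le : 0 ≤ t)
  have h0 : ∫ ω, min (V (X 0 ω)) N ∂P ≤ V x₀ := by
    have : ∫ ω, min (V (X 0 ω)) N ∂P = ∫ _ : Ω, min (V x₀) N ∂P := by
      refine integral_congr_ae ?_
      filter_upwards [hX.initial] with ω hω
      rw [hω]
    rw [this]
    simp
  have h1 : 0 ≤ ∫ u in ((0 : ℝ≥0) : ℝ)..t,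
      ∫ ω, (if V (X u.toNNReal ω) < N then V (X u.toNNReal ω) else 0) ∂P :=
    intervalIntegral.integral_nonneg t.2 fun u _ => integral_ite_nonneg hV N _
  have h2 := mul_nonneg hc h1
  rw [NNReal.coe_zero, sub_zero] at h
  rw [NNReal.coe_zero] at h2
  linarith

theorem integrable_lyapunov (hX : IsWalkerProcess θl β P 𝓕 x₀ X) (hβ : 0 ≤ β)
    (hV : ∀ x, 0 ≤ V x) (hc : 0 ≤ c) (hK : 0 ≤ K)
    (hdrift : ∀ x, generator θl β V x ≤ K - c * V x) (t : ℝ≥0) :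
    Integrable (fun ω => V (X t ω)) P :=
  integrable_of_integral_min_le (hX.measurable_comp V t) (fun _ => hV _) _
    fun N => hX.integral_min_le hβ hV hc hK hdrift N t

theorem integral_lyapunov_le (hX : IsWalkerProcess θl β P 𝓕 x₀ X) (hβ : 0 ≤ β)
    (hV : ∀ x, 0 ≤ V x) (hc : 0 ≤ c) (hK : 0 ≤ K)
    (hdrift : ∀ x, generator θl β V x ≤ K - c * V x) (t : ℝ≥0) :
    ∫ ω, V (X t ω) ∂P ≤ V x₀ + K * t :=
  le_of_tendsto' (tendsto_integral_min (hX.integrable_lyapunov hβ hV hc hK hdrift t)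
    fun _ => hV _) fun N => hX.integral_min_le hβ hV hc hK hdrift N t

theorem intervalIntegrable_lyapunov (hX : IsWalkerProcess θl β P 𝓕 x₀ X) (hβ : 0 ≤ β)
    (hV : ∀ x, 0 ≤ V x) (hc : 0 ≤ c) (hK : 0 ≤ K)
    (hdrift : ∀ x, generator θl β V x ≤ K - c * V x) (s t : ℝ≥0) :
    IntervalIntegrable (fun u : ℝ => ∫ ω, V (X u.toNNReal ω) ∂P) volume s t := by
  have hb : IntervalIntegrable (fun u : ℝ => V x₀ + K * u.toNNReal) volume s t :=
    (by fun_prop : Continuous fun u : ℝ => V x₀ + K * u.toNNReal).intervalIntegrable _ _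
  refine hb.mono_fun (hX.measurable_integral V).aestronglyMeasurable (ae_of_all _ fun u => ?_)
  dsimp only
  have h := hX.integral_lyapunov_le hβ hV hc hK hdrift u.toNNReal
  rw [Real.norm_of_nonneg (integral_nonneg fun _ => hV _)]
  exact h.trans (le_abs_self _)

/-- Limit `N → ∞` of `integral_min_add_le`; the time integral is dominated by `u ↦ E V(X_u)`,
integrable thanks to the linear growth bound. -/
theorem integral_lyapunov_add_le (hX : IsWalkerProcess θl β P 𝓕 x₀ X) (hβ : 0 ≤ β)
    (hV : ∀ x, 0 ≤ V x) (hc : 0 ≤ c) (hK : 0 ≤ K)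
    (hdrift : ∀ x, generator θl β V x ≤ K - c * V x) {s t : ℝ≥0} (hst : s ≤ t) :
    ∫ ω, V (X t ω) ∂P + c * ∫ u in (s : ℝ)..t, ∫ ω, V (X u.toNNReal ω) ∂P ≤
      ∫ ω, V (X s ω) ∂P + K * (t - s) := by
  have hI := hX.integrable_lyapunov hβ hV hc hK hdrift
  have hlim : Tendsto (fun N : ℕ => ∫ u in (s : ℝ)..t,
      ∫ ω, (if V (X u.toNNReal ω) < N then V (X u.toNNReal ω) else 0) ∂P) atTop
      (𝓝 (∫ u in (s : ℝ)..t, ∫ ω, V (X u.toNNReal ω) ∂P)) := by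
    refine intervalIntegral.tendsto_integral_filter_of_dominated_convergence
      (fun u : ℝ => ∫ ω, V (X u.toNNReal ω) ∂P)
      (Eventually.of_forall fun N => (hX.measurable_integral
        (fun x => if V x < N then V x else 0)).aestronglyMeasurable)
      (Eventually.of_forall fun N => ae_of_all _ fun u _ => ?_)
      (hX.intervalIntegrable_lyapunov hβ hV hc hK hdrift s t)
      (ae_of_all _ fun u _ => tendsto_integral_ite_lt (hX.measurable_comp V _) (hI _)
        fun _ => hV _)
    rw [Real.norm_of_nonneg (integral_ite_nonneg hV N _)]
    refine integral_mono (hX.integrable_comp (exists_ite_bound hV N) _) (hI _) fun ω => ?_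
    dsimp only
    split_ifs
    · exact le_rfl
    · exact hV _
  exact le_of_tendsto_of_tendsto'
    ((tendsto_integral_min (hI t) fun _ => hV _).add (hlim.const_mul c))
    ((tendsto_integral_min (hI s) fun _ => hV _).add_const _)
    fun N => hX.integral_min_add_le hβ hV hK hdrift N hst

theorem integral_lyapunov_le_add (hX : IsWalkerProcess θl β P 𝓕 x₀ X) (hβ : 0 ≤ β)
    (hV : ∀ x, 0 ≤ V x) (hc : 0 ≤ c) (hK : 0 ≤ K)
    (hdrift : ∀ x, generator θl β V x ≤ K - c * V x) {s t : ℝ≥0} (hst : s ≤ t) :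
    ∫ ω, V (X t ω) ∂P ≤ ∫ ω, V (X s ω) ∂P + K * (t - s) := by
  have h := hX.integral_lyapunov_add_le hβ hV hc hK hdrift hst
  have h1 : 0 ≤ ∫ u in (s : ℝ)..t, ∫ ω, V (X u.toNNReal ω) ∂P :=
    intervalIntegral.integral_nonneg (by exact_mod_cast hst) fun u _ =>
      integral_nonneg fun _ => hV _
  have h2 := mul_nonneg hc h1
  linarith

theorem integral_lyapunov_step (hX : IsWalkerProcess θl β P 𝓕 x₀ X) (hβ : 0 ≤ β)
    (hV : ∀ x, 0 ≤ V x) (hc : 0 ≤ c) (hK : 0 ≤ K)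
    (hdrift : ∀ x, generator θl β V x ≤ K - c * V x) (s : ℝ≥0) :
    (1 + c) * ∫ ω, V (X (s + 1) ω) ∂P ≤ ∫ ω, V (X s ω) ∂P + (1 + c) * K := by
  have h := hX.integral_lyapunov_add_le hβ hV hc hK hdrift (le_add_of_nonneg_right zero_le_one :
    s ≤ s + 1)
  have hs : (s : ℝ) ≤ ((s + 1 : ℝ≥0) : ℝ) := by push_cast; linarith
  -- The expectation grows by at most `K` in unit time, so its final value, less `K`, bounds it from
  -- below on the whole interval. This replaces a Gronwall argument.
  have hlow : ∫ _ in (s : ℝ)..((s + 1 : ℝ≥0) : ℝ), (∫ ω, V (X (s + 1) ω) ∂P - K) ≤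
      ∫ u in (s : ℝ)..((s + 1 : ℝ≥0) : ℝ), ∫ ω, V (X u.toNNReal ω) ∂P := by
    refine intervalIntegral.integral_mono_on hs intervalIntegrable_const
      (hX.intervalIntegrable_lyapunov hβ hV hc hK hdrift s (s + 1)) fun u hu => ?_
    have hu0 : 0 ≤ u := s.2.trans hu.1
    have hu1 : u.toNNReal ≤ s + 1 := by
      rw [Real.toNNReal_le_iff_le_coe]
      exact hu.2
    have h1 := hX.integral_lyapunov_le_add hβ hV hc hK hdrift hu1
    rw [Real.coe_toNNReal u hu0] at h1
    have h2 : ((s + 1 : ℝ≥0) : ℝ) - u ≤ 1 := by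
      have := hu.1
      push_cast
      linarith
    have h3 := mul_le_mul_of_nonneg_left h2 hK
    linarith
  rw [intervalIntegral.integral_const, smul_eq_mul] at hlow
  have h4 : ((s + 1 : ℝ≥0) : ℝ) - s = 1 := by push_cast; ring
  rw [h4] at h hlow
  have h5 := mul_le_mul_of_nonneg_left hlow hc
  linarith

/-- The expectation of a function with drift at most `K - cV` stays bounded. -/
theorem exists_integral_lyapunov_bound (hX : IsWalkerProcess θl β P 𝓕 x₀ X) (hβ : 0 ≤ β)
    (hV : ∀ x, 0 ≤ V x) (hc : 0 < c) (hK : 0 ≤ K)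
    (hdrift : ∀ x, generator θl β V x ≤ K - c * V x) :
    ∃ C, ∀ t : ℝ≥0, ∫ ω, V (X t ω) ∂P ≤ C := by
  -- `V x₀ + K` covers times up to `1`; `(1 + c) * K / c` is the fixed point of the recursion `m ↦ m
  -- / (1 + c) + K` given by the unit step.
  have hbound : ∀ (k : ℕ) (r : ℝ≥0), r ≤ 1 →
      ∫ ω, V (X (r + k) ω) ∂P ≤ V x₀ + K + (1 + c) * K / c := by
    intro k r hr
    induction k with
    | zero =>
      have h := hX.integral_lyapunov_le hβ hV hc.le hK hdrift r
      have h1 := mul_le_mul_of_nonneg_left (show (r : ℝ) ≤ 1 by exact_mod_cast hr) hK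
      have h2 : 0 ≤ (1 + c) * K / c := by positivity
      rw [Nat.cast_zero, add_zero]
      linarith
    | succ k ih =>
      have h := hX.integral_lyapunov_step hβ hV hc.le hK hdrift (r + k)
      rw [add_assoc, ← Nat.cast_succ] at h
      have h1 : 0 ≤ c * (V x₀ + K) := mul_nonneg hc.le (add_nonneg (hV _) hK)
      have h2 : c * ((1 + c) * K / c) = (1 + c) * K := by field_simp
      have h3 : (1 + c) * ∫ ω, V (X (r + (k.succ : ℕ)) ω) ∂P ≤
          (1 + c) * (V x₀ + K + (1 + c) * K / c) := by linarith
      exact le_of_mul_le_mul_left h3 (by linarith)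
  refine ⟨V x₀ + K + (1 + c) * K / c, fun t => ?_⟩
  have h := hbound ⌊t⌋₊ (t - ⌊t⌋₊) (by
    rw [tsub_le_iff_left]
    exact (Nat.lt_floor_add_one t).le)
  rwa [tsub_add_cancel_of_le (Nat.floor_le zero_le)] at h

end Drift

end IsWalkerProcess

end Shocks

/-! ### Moments of the width. -/

theorem lemma4p2 (θl β : ℝ) (hβ : 0 < β) (n : ℕ) (hn : 0 < n) (x₀ : Sym ℤ n)
    {Ω : Type*} {mΩ : MeasurableSpace Ω} (P : Measure Ω) [IsProbabilityMeasure P]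
    (𝓕 : Filtration ℝ≥0 mΩ) (X : ℝ≥0 → Ω → Sym ℤ n)
    (hX : Shocks.IsWalkerProcess θl β P 𝓕 x₀ X) (p : ℕ) :
    ∃ C : ℝ, ∀ t : ℝ≥0,
      Integrable (fun ω => (Shocks.width (X t ω) : ℝ) ^ p) P ∧
        ∫ ω, (Shocks.width (X t ω) : ℝ) ^ p ∂P ≤ C := by
  obtain ⟨a, ha, c, hc, K, hK, hdrift⟩ := Shocks.exists_drift θl β hβ n
  obtain ⟨C, hC⟩ := hX.exists_integral_lyapunov_bound hβ.le (Shocks.pairSum_nonneg a) hc hK hdrift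
  refine ⟨(p.factorial : ℝ) / a ^ p * C, fun t => ?_⟩
  have hV := (hX.integrable_lyapunov hβ.le (Shocks.pairSum_nonneg a) hc.le hK hdrift t).const_mul
    ((p.factorial : ℝ) / a ^ p)
  have hle : ∀ ω, (Shocks.width (X t ω) : ℝ) ^ p ≤
      (p.factorial : ℝ) / a ^ p * Shocks.pairSum a (X t ω) := fun ω =>
    Shocks.width_pow_le a ha hn _ p
  have hint : Integrable (fun ω => (Shocks.width (X t ω) : ℝ) ^ p) P := by
    refine hV.mono' (hX.measurable_comp (fun x => (Shocks.width x : ℝ) ^ p)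
      t).aestronglyMeasurable (ae_of_all _ fun ω => ?_)
    have hw : (0 : ℝ) ≤ Shocks.width (X t ω) := by exact_mod_cast Shocks.width_nonneg hn _
    rw [Real.norm_of_nonneg (pow_nonneg hw p)]
    exact hle ω
  refine ⟨hint, (integral_mono hint hV hle).trans ?_⟩
  rw [integral_const_mul]
  exact mul_le_mul_of_nonneg_left (hC t) (by positivity)
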